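/- **Scheduling with $m$ operations.** An instance consists of finitely many jobs. Each job $j$ has an integer release date $r_j\ge 0$ and consists of $m$ operations with integer lengths $p_{j_1},\dots,p_{j_m}\ge 0$ and total length $p_j=\sum_{i=1}^m p_{j_i}\ge 1$, which have to be processed in this order. In each interval $[t,t+1]$, $t=0,1,2,\dots$, a schedule processes at most one released, unfinished job for one unit. The completion time $C_j$ is the first time at which job $j$ has received $p_j$ units of processing ($C_j=\infty$ if this never happens), and the cost of the schedule is the total flow time $\sum_j (C_j-r_j)$. Let $\mathrm{OPT}(I)$ be the minimum cost of a schedule for the instance $I$. An online algorithm chooses the job to process in $[t,t+1]$ (or to idle) knowing only what has been revealed up to time $t$: the jobs released by time $t$ with their release dates, the processing they have received, and, for each of them, the lengths of its operations up to and including its active operation, i.e. of those operations all of whose predecessors are completed. A randomized algorithm is a random deterministic online algorithm; against an oblivious adversary, its competitive ratio for $m$ operations is the infimum of all $\rho\in[0,\infty]$ with $\mathbb{E}[\mathrm{ALG}(I)]\le\rho\cdot\mathrm{OPT}(I)$ for every instance $I$ with $m$ operations, where the instance is fixed independently of the random choices of the algorithm. **Theorem.** The competitive ratio of any randomized algorithm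 against an oblivious adversary for minimizing the total flow time with $m$ operations is $\Omega(m)$: there is an absolute constant $c>0$ such that for every integer $m\ge 1$, every randomized algorithm (even one that knows $m$) has competitive ratio at least $c\cdot m$ on instances with $m$ operations. -/

import Mathlib

open MeasureTheory
open scoped ENNReal NNReal

namespace OpFlow

/-- An instance of single-machine scheduling with `m` operations: `n` jobs with integer release
dates, each composed of `m` integer operation lengths (possibly zero) of positive total. -/
structure JobInstance (m : ℕ) where
  n : ℕ
  release : Fin n → ℕ
  op : Fin n → Fin m → ℕ
  size_pos : ∀ j, 1 ≤ ∑ i, op j i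

namespace JobInstance

variable {m : ℕ} (I : JobInstance m)

/-- The processing time `p_j` of job `j`. -/
def size (j : Fin I.n) : ℕ := ∑ i, I.op j i

/-- A schedule says which job, if any, is processed in each interval `[t, t+1]`. -/
abbrev Schedule : Type := ℕ → Option (Fin I.n)

/-- `y_j(t)`: the processing that job `j` has received until time `t`. -/
def processed (σ : I.Schedule) (j : Fin I.n) (t : ℕ) : ℕ :=
  ((Finset.range t).filter (fun s => σ s = some j)).card

/-- Only released and unfinished jobs are processed. -/
def Feasible (σ : I.Schedule) : Prop :=
  ∀ t j, σ t = some j → I.release j ≤ t ∧ I.processed σ j t < I.size j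

/-- The first time at which job `j` has received `p_j` units of processing
(`⊤` if there is no such time). -/
noncomputable def completionTime (σ : I.Schedule) (j : Fin I.n) : ℕ∞ :=
  ⨅ (t : ℕ) (_ : I.size j ≤ I.processed σ j t), (t : ℕ∞)

/-- The total flow time `∑ j, (C_j - r_j)`. -/
noncomputable def totalFlow (σ : I.Schedule) : ℕ∞ :=
  ∑ j, (I.completionTime σ j - (I.release j : ℕ∞))

/-- The optimal (offline) total flow time. -/
noncomputable def opt : ℕ∞ :=
  ⨅ (σ : I.Schedule) (_ : I.Feasible σ), I.totalFlow σ

end JobInstance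

/-- What an online algorithm sees of a released job: its label, its release date, the processing
it has received so far, and the lengths of its operations up to and including the active one
(all of its operations once it is completed). The job is completed exactly if the revealed lengths
sum up to the processing received. -/
structure JobView where
  label : ℕ
  release : ℕ
  processed : ℕ
  revealed : List ℕ

/-- What an online algorithm sees at one point in time: the released jobs. -/
abbrev Observation : Type := List JobView

/-- A deterministic online algorithm: from the observations at times `0, ..., t` it decides which
job (given by its label) to process in `[t, t+1]`, or to idle. -/
abbrev OnlineAlgorithm : Type := List Observation → Option ℕ

namespace JobInstance

variable {m : ℕ} (I : JobInstance m)

/-- The lengths of the operations of job `j` that are revealed after `y` units of processing of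
`j`: those all of whose predecessors are completed. -/
def revealed (j : Fin I.n) (y : ℕ) : List ℕ :=
  ((List.finRange m).filter (fun i => ∑ k ∈ Finset.Iio i, I.op j k ≤ y)).map (I.op j)

/-- The observation at time `t` if each job `j` has received `y j` units of processing. -/
def observe (t : ℕ) (y : Fin I.n → ℕ) : Observation :=
  ((List.finRange I.n).filter (fun j => I.release j ≤ t)).map
    (fun j : Fin I.n => ⟨j.val, I.release j, y j, I.revealed j (y j)⟩)

/-- The job that is processed at time `t` when the algorithm asks for the label `d`; asking for
a job that does not exist, is not released, or is completed means idling. -/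
def select (t : ℕ) (y : Fin I.n → ℕ) (d : Option ℕ) : Option (Fin I.n) :=
  d.bind fun k =>
    if h : k < I.n then
      if I.release ⟨k, h⟩ ≤ t ∧ y ⟨k, h⟩ < I.size ⟨k, h⟩ then some ⟨k, h⟩ else none
    else none

/-- Running the algorithm `A`: the processing received by each job until time `t`, and the
observations made at the times before `t`. -/
def run {m : ℕ} (I : JobInstance m) (A : OnlineAlgorithm) : ℕ → (Fin I.n → ℕ) × List Observation
  | 0 => (fun _ => 0, [])
  | t + 1 =>
    let y := (run I A t).1
    let h := (run I A t).2 ++ [I.observe t y]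
    (fun j => y j + if I.select t y (A h) = some j then 1 else 0, h)

/-- The schedule that the algorithm `A` produces. -/
def schedule (A : OnlineAlgorithm) : I.Schedule := fun t =>
  I.select t (I.run A t).1 (A ((I.run A t).2 ++ [I.observe t (I.run A t).1]))

/-- The total flow time of the algorithm `A`. -/
noncomputable def cost (A : OnlineAlgorithm) : ℕ∞ := I.totalFlow (I.schedule A)

end JobInstance

/-- A randomized online algorithm: a random deterministic online algorithm, i.e. a family of
deterministic ones indexed by a probability space such that every single decision is an event. -/
structure RandomizedAlgorithm (Ω : Type*) [MeasurableSpace Ω] where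
  toAlgorithm : Ω → OnlineAlgorithm
  measurable_decision : ∀ (h : List Observation) (d : Option ℕ),
    MeasurableSet {ω | toAlgorithm ω h = d}

/-- `A` is `ρ`-competitive on instances with `m` operations against an oblivious adversary: on
every instance (fixed before the coins are drawn) its expected total flow time is at most `ρ` times
the optimum. -/
def IsCompetitive {Ω : Type*} [MeasurableSpace Ω] (P : Measure Ω) (A : RandomizedAlgorithm Ω)
    (m : ℕ) (ρ : ℝ≥0∞) : Prop :=
  ∀ I : JobInstance m, ∫⁻ ω, (I.cost (A.toAlgorithm ω) : ℝ≥0∞) ∂P ≤ ρ * (I.opt : ℝ≥0∞)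

/-- The competitive ratio of `A` for scheduling with `m` operations. -/
noncomputable def competitiveRatio {Ω : Type*} [MeasurableSpace Ω] (P : Measure Ω)
    (A : RandomizedAlgorithm Ω) (m : ℕ) : ℝ≥0∞ :=
  sInf {ρ | IsCompetitive P A m ρ}

end OpFlow

/-!
The lower bound follows from Yao's principle, applied to a random instance with `m = d + 1`
operations of length zero or one. At time `0`, `N = 4 ^ d` jobs are released, whose sizes are
independent geometric random variables truncated at `d + 1` (`coinSize`): after each unit of
processing except the last possible one, a fair coin decides whether a further operation of length
one follows. This coin is revealed only when the preceding operation is completed.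

*The algorithm.* Since the sizes are memoryless, a unit of processing completes a job of less than
the maximal size with probability at most `1 / 2`, whatever the algorithm does. Formally, inverting
the deciding coin is an injection from the coin sequences for which such a completion happens at
time `t` to those for which it does not (`two_mul_card_completesAt_le`), because the run up to time
`t` does not depend on this coin (`run_unitInstance_congr`). Hence at time `T` at least
`N - T / 2 - N / 2 ^ d` jobs are unfinished on average (`le_sum_card_alive`).

*The optimum.* The time `T` is the expected total work on the jobs of less than the maximal size. An
offline schedule that processes these first has finished all of them at time `T`, up to a random
fluctuation of order `√N = 2 ^ d` (`sum_excess_le`); the expected number of jobs of the maximal size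
is `N / 2 ^ d = 2 ^ d` as well. So it has `O(2 ^ d)` unfinished jobs (`opt_coinInstance_le`), whereas
`N - T / 2 - N / 2 ^ d = 2 ^ d * d / 2`.

*The stream.* From time `T` on, one unit job is released per unit of time, for a long time. At most
one job is completed per unit of time, so the algorithm keeps its surplus of unfinished jobs
(`mul_card_alive_le_cost`), while the optimum processes the unit jobs as they arrive. For a long
stream, the ratio of the expected costs is therefore of order `d`. The unit job that has just
arrived contributes one more unfinished job, which covers the case `d = 0`.

Both averages are taken over the finite set of coin sequences. Exchanging them with the expectation
over the coins of the algorithm needs the number of unfinished jobs at time `T` to be measurable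
(`measurable_numAlive`).
-/

namespace OpFlow

/-! ### Flow time and the number of unfinished jobs -/

namespace JobInstance

variable {m : ℕ} (I : JobInstance m)

lemma processed_zero (σ : I.Schedule) (j : Fin I.n) : I.processed σ j 0 = 0 := by
  simp [processed]

lemma processed_succ (σ : I.Schedule) (j : Fin I.n) (t : ℕ) :
    I.processed σ j (t + 1) = I.processed σ j t + if σ t = some j then 1 else 0 := by
  unfold processed
  rw [Finset.range_add_one, Finset.filter_insert]
  split_ifs with h <;> simp

lemma processed_mono (σ : I.Schedule) (j : Fin I.n) : Monotone (I.processed σ j) :=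
  monotone_nat_of_le_succ fun t => by rw [processed_succ]; omega

lemma run_fst_eq_processed (A : OnlineAlgorithm) (t : ℕ) (j : Fin I.n) :
    (I.run A t).1 j = I.processed (I.schedule A) j t := by
  induction t with
  | zero => simp [run, processed_zero]
  | succ t ih =>
    rw [processed_succ, ← ih]
    rfl

lemma of_select_eq_some {t : ℕ} {y : Fin I.n → ℕ} {d : Option ℕ} {j : Fin I.n}
    (h : I.select t y d = some j) : I.release j ≤ t ∧ y j < I.size j := by
  unfold select at h
  rcases d with _ | k
  · simp at h
  · simp only [Option.bind_some] at h
    split_ifs at h with h1 h2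
    cases h
    exact h2

lemma feasible_schedule (A : OnlineAlgorithm) : I.Feasible (I.schedule A) := fun t j h => by
  have := I.of_select_eq_some h
  rwa [run_fst_eq_processed] at this

/-- A feasible schedule does not process a job before its release date. -/
lemma Feasible.processed_eq_zero {I : JobInstance m} {σ : I.Schedule} (hσ : I.Feasible σ)
    {j : Fin I.n} {t : ℕ} (ht : t ≤ I.release j) : I.processed σ j t = 0 := by
  induction t with
  | zero => exact I.processed_zero σ j
  | succ t ih =>
    rw [processed_succ, ih (by omega), if_neg fun h => ?_]
    have := (hσ t j h).1
    omega

/-- The released and unfinished jobs at time `t`. -/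
def alive (σ : I.Schedule) (t : ℕ) : Finset (Fin I.n) :=
  Finset.univ.filter fun j => I.release j ≤ t ∧ I.processed σ j t < I.size j

lemma mem_alive {σ : I.Schedule} {t : ℕ} {j : Fin I.n} :
    j ∈ I.alive σ t ↔ I.release j ≤ t ∧ I.processed σ j t < I.size j := by
  simp [alive]

/-- The total flow time is the integral over time of the number of unfinished jobs; here it is
bounded below by the contribution of finitely many unit intervals. -/
lemma sum_card_alive_le_totalFlow (σ : I.Schedule) (S : Finset ℕ) :
    ((∑ t ∈ S, (I.alive σ t).card : ℕ) : ℕ∞) ≤ I.totalFlow σ := by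
  classical
  have hswap : ∑ t ∈ S, (I.alive σ t).card = ∑ j, (S.filter fun t => j ∈ I.alive σ t).card := by
    simp only [Finset.card_eq_sum_ones, Finset.sum_filter, alive]
    rw [Finset.sum_comm]
    simp
  rw [hswap, totalFlow, Nat.cast_sum]
  refine Finset.sum_le_sum fun j _ => ?_
  set F := S.filter fun t => j ∈ I.alive σ t with hF
  rcases F.eq_empty_or_nonempty with h0 | ⟨t₁, ht₁⟩
  · simp [h0]
  refine ENat.le_sub_of_add_le_right (ENat.natCast_ne_top _) (le_iInf₂ fun t₀ ht₀ => ?_)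
  have key : ∀ t ∈ F, I.release j ≤ t ∧ t < t₀ := by
    intro t ht
    have h1 := I.mem_alive.1 (Finset.mem_filter.1 ht).2
    refine ⟨h1.1, lt_of_not_ge fun hle => ?_⟩
    have := I.processed_mono σ j hle
    omega
  have hcard : F.card ≤ t₀ - I.release j := by
    rw [← Nat.card_Ico]
    exact Finset.card_le_card fun t ht => Finset.mem_Ico.2 (key t ht)
  have h1 := key t₁ ht₁
  have : F.card + I.release j ≤ t₀ := by omega
  exact_mod_cast this

/-- While a new job is released, the number of unfinished jobs cannot drop, since at most one job is
completed per unit of time. -/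
lemma Feasible.card_alive_le_succ {I : JobInstance m} {σ : I.Schedule} (hσ : I.Feasible σ) {t : ℕ}
    {j₀ : Fin I.n} (hj₀ : I.release j₀ = t + 1) :
    (I.alive σ t).card ≤ (I.alive σ (t + 1)).card := by
  classical
  have hnot : j₀ ∉ I.alive σ t := fun h => by
    have := (I.mem_alive.1 h).1
    omega
  have hin : j₀ ∈ I.alive σ (t + 1) := I.mem_alive.2 ⟨hj₀.le, by
    rw [hσ.processed_eq_zero hj₀.ge]
    exact I.size_pos j₀⟩
  have stay : ∀ j ∈ I.alive σ t, σ t ≠ some j → j ∈ I.alive σ (t + 1) := by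
    intro j hj hne
    rw [mem_alive] at hj ⊢
    rw [processed_succ, if_neg hne]
    omega
  rcases hs : σ t with _ | j₁
  · exact Finset.card_le_card fun j hj => stay j hj (by simp [hs])
  · have hsub : insert j₀ ((I.alive σ t).erase j₁) ⊆ I.alive σ (t + 1) := by
      intro j hj
      rcases Finset.mem_insert.1 hj with rfl | hj
      · exact hin
      · obtain ⟨hne, hj⟩ := Finset.mem_erase.1 hj
        exact stay j hj (by rw [hs]; simpa using hne.symm)
    have h1 := Finset.card_le_card hsub
    rw [Finset.card_insert_of_notMem fun h => hnot (Finset.mem_of_mem_erase h)] at h1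
    have h2 := Finset.pred_card_le_card_erase (s := I.alive σ t) (a := j₁)
    omega

end JobInstance

/-! ### Instances with unit operations, and what an online algorithm sees of them -/

/-- The instance whose job `j` is released at `r j` and whose first `p j` operations have length
one, all others having length zero. -/
abbrev unitInstance (d n : ℕ) (r p : Fin n → ℕ) (hp : ∀ j, 1 ≤ p j) : JobInstance (d + 1) where
  n := n
  release := r
  op j i := if i.val < p j then 1 else 0
  size_pos j := by
    refine le_trans ?_ (Finset.single_le_sum
      (f := fun i : Fin (d + 1) => if i.val < p j then 1 else 0) (fun _ _ => Nat.zero_le _) (Finset.mem_univ 0))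
    exact (if_pos (hp j)).ge

section UnitInstance

variable {d n : ℕ} {r p p' : Fin n → ℕ} {hp : ∀ j, 1 ≤ p j} {hp' : ∀ j, 1 ≤ p' j}

lemma size_unitInstance {j : Fin n} (hj : p j ≤ d + 1) :
    (unitInstance d n r p hp).size j = p j := by
  change ∑ i : Fin (d + 1), (if i.val < p j then 1 else 0) = p j
  rw [Fin.sum_univ_eq_sum_range (fun i => if i < p j then 1 else 0), ← Finset.sum_filter,
    ← Finset.card_eq_sum_ones]
  have : (Finset.range (d + 1)).filter (· < p j) = Finset.range (p j) := by
    ext i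
    simp
    omega
  rw [this, Finset.card_range]

/-- As long as a job is unfinished, its active operation is the one whose index is the amount of
processing received. -/
lemma sum_op_unitInstance_le_iff {j : Fin n} {y : ℕ} (hy : y < p j) (i : Fin (d + 1)) :
    ∑ k ∈ Finset.Iio i, (unitInstance d n r p hp).op j k ≤ y ↔ i.val ≤ y := by
  change ∑ k ∈ Finset.Iio i, (if k.val < p j then 1 else 0) ≤ y ↔ i.val ≤ y
  rw [← Finset.sum_filter, ← Finset.card_eq_sum_ones]
  constructor
  · intro h
    by_contra hlt
    push Not at hlt
    have hsub : Finset.Iic (⟨y, by omega⟩ : Fin (d + 1)) ⊆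
        (Finset.Iio i).filter fun k => k.val < p j := by
      intro k hk
      have hk' : k.val ≤ y := Fin.le_def.1 (Finset.mem_Iic.1 hk)
      exact Finset.mem_filter.2 ⟨Finset.mem_Iio.2 (Fin.lt_def.2 (by omega)), by omega⟩
    have := Finset.card_le_card hsub
    rw [Fin.card_Iic] at this
    simp only at this
    omega
  · intro h
    refine (Finset.card_filter_le _ _).trans ?_
    rwa [Fin.card_Iio]

lemma revealed_unitInstance {j : Fin n} {y : ℕ} (hy : y < p j) :
    (unitInstance d n r p hp).revealed j y =
      ((List.finRange (d + 1)).filter fun i => i.val ≤ y).map fun _ => 1 := by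
  unfold JobInstance.revealed
  rw [List.filter_congr (q := fun i => decide (i.val ≤ y)) fun i _ =>
    decide_eq_decide.2 (sum_op_unitInstance_le_iff hy i)]
  refine List.map_congr_left fun i hi => ?_
  have : i.val ≤ y := by simpa using (List.mem_filter.1 hi).2
  exact if_pos (by omega)

/-- If two instances differ in a single job `j₀`, whose size is at least `k` in both, then no online
algorithm distinguishes them before it has processed `j₀` for `k` units. -/
lemma run_unitInstance_congr (A : OnlineAlgorithm) (hd : ∀ j, p j ≤ d + 1)
    (hd' : ∀ j, p' j ≤ d + 1) {j₀ : Fin n} {k : ℕ} (hne : ∀ j, j ≠ j₀ → p j = p' j)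
    (hk : k ≤ p j₀) (hk' : k ≤ p' j₀) (t : ℕ)
    (ht : ((unitInstance d n r p hp).run A t).1 j₀ < k) :
    (unitInstance d n r p hp).run A t = (unitInstance d n r p' hp').run A t ∧
      (unitInstance d n r p hp).schedule A t = (unitInstance d n r p' hp').schedule A t := by
  have hobs : ∀ (s : ℕ) (y : Fin n → ℕ), y j₀ < k →
      (unitInstance d n r p hp).observe s y = (unitInstance d n r p' hp').observe s y := by
    intro s y hy
    refine List.map_congr_left fun j _ => ?_
    have : (unitInstance d n r p hp).revealed j (y j) =
        (unitInstance d n r p' hp').revealed j (y j) := by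
      by_cases hj : j = j₀
      · subst hj
        rw [revealed_unitInstance (by omega), revealed_unitInstance (by omega)]
      · simp only [JobInstance.revealed, hne j hj]
    rw [this]
  have hsel : ∀ (s : ℕ) (y : Fin n → ℕ) (c : Option ℕ), y j₀ < k →
      (unitInstance d n r p hp).select s y c = (unitInstance d n r p' hp').select s y c := by
    intro s y c hy
    have hiff : ∀ j, y j < (unitInstance d n r p hp).size j ↔
        y j < (unitInstance d n r p' hp').size j := by
      intro j
      rw [size_unitInstance (hd j), size_unitInstance (hd' j)]
      by_cases hj : j = j₀
      · subst hj
        omega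
      · rw [hne j hj]
    simp only [JobInstance.select, hiff]
  have hrun : (unitInstance d n r p hp).run A t = (unitInstance d n r p' hp').run A t := by
    induction t with
    | zero => rfl
    | succ t ih =>
      have hlt : ((unitInstance d n r p hp).run A t).1 j₀ < k := lt_of_le_of_lt (by
        rw [JobInstance.run_fst_eq_processed, JobInstance.run_fst_eq_processed]
        exact JobInstance.processed_mono _ _ _ (Nat.le_succ t)) ht
      have e := ih hlt
      have hlt' := hlt
      rw [e] at hlt'
      simp only [JobInstance.run]
      rw [e, hobs t _ hlt']
      simp only [hsel t _ _ hlt']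
  refine ⟨hrun, ?_⟩
  have ht' := ht
  rw [hrun] at ht'
  simp only [JobInstance.schedule]
  rw [hrun, hobs t _ ht', hsel t _ _ ht']

end UnitInstance

/-! ### Truncated geometric sizes -/

section Sizes

variable {d : ℕ}

lemma exists_stop (b : Fin d → Bool) : ∃ k, ∀ h : k < d, b ⟨k, h⟩ = false :=
  ⟨d, fun h => absurd h (lt_irrefl d)⟩

/-- One plus the number of leading `true`s of a sequence of `d` coins: for uniform coins this is a
geometric random variable truncated at `d + 1`. -/
def coinSize (b : Fin d → Bool) : ℕ := Nat.find (exists_stop b) + 1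

lemma lt_coinSize_iff (b : Fin d → Bool) (k : ℕ) :
    k < coinSize b ↔ ∀ c < k, ∃ h : c < d, b ⟨c, h⟩ = true := by
  simp [coinSize, Nat.le_find_iff]

lemma one_le_coinSize (b : Fin d → Bool) : 1 ≤ coinSize b := Nat.succ_pos _

lemma coinSize_le (b : Fin d → Bool) : coinSize b ≤ d + 1 :=
  Nat.succ_le_succ (Nat.find_min' _ fun h => absurd h (lt_irrefl d))

lemma card_lt_coinSize {i : ℕ} (hi : i ≤ d) :
    (Finset.univ.filter fun b : Fin d → Bool => i < coinSize b).card = 2 ^ (d - i) := by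
  have h1 : (Finset.univ.filter fun b : Fin d → Bool => i < coinSize b) =
      Fintype.piFinset fun c : Fin d => if c.val < i then {true} else Finset.univ := by
    ext b
    simp only [Finset.mem_filter, Finset.mem_univ, true_and, lt_coinSize_iff, Fintype.mem_piFinset]
    constructor
    · intro h c
      split_ifs with hc
      · obtain ⟨_, h2⟩ := h c hc
        simpa using h2
      · simp
    · intro h c hc
      have := h ⟨c, by omega⟩
      rw [if_pos hc] at this
      exact ⟨by omega, by simpa using this⟩
  rw [h1, Fintype.card_piFinset]
  have h2 : ∀ c : Fin d, (if c.val < i then ({true} : Finset Bool) else Finset.univ).card =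
      if c.val < i then 1 else 2 := fun c => by split_ifs <;> simp
  simp only [h2]
  rw [Fin.prod_univ_eq_prod_range (fun c => if c < i then 1 else 2), Finset.prod_ite]
  simp only [Finset.prod_const, one_pow, one_mul]
  congr 1
  have : (Finset.range d).filter (fun c => ¬ c < i) = Finset.Ico i d := by
    ext c
    simp
    omega
  rw [this, Nat.card_Ico]

lemma card_filter_coinSize_eq :
    (Finset.univ.filter fun b : Fin d → Bool => d < coinSize b).card = 1 := by
  simp [card_lt_coinSize le_rfl]

/-- Summation by layers. -/
lemma sum_sum_range_coinSize (w : ℕ → ℕ) :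
    ∑ b : Fin d → Bool, ∑ i ∈ Finset.range (coinSize b), w i =
      ∑ i ∈ Finset.range (d + 1), w i * 2 ^ (d - i) := by
  have h : ∀ b : Fin d → Bool, ∑ i ∈ Finset.range (coinSize b), w i =
      ∑ i ∈ Finset.range (d + 1), if i < coinSize b then w i else 0 := by
    intro b
    rw [← Finset.sum_filter]
    congr 1
    ext i
    have := coinSize_le b
    simp
    omega
  simp only [h]
  rw [Finset.sum_comm]
  refine Finset.sum_congr rfl fun i hi => ?_
  rw [← Finset.sum_filter, Finset.sum_const, card_lt_coinSize (by simpa [Nat.lt_succ_iff] using hi),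
    smul_eq_mul, mul_comm]

lemma sum_coinSize : ∑ b : Fin d → Bool, coinSize b + 1 = 2 * 2 ^ d := by
  have h := sum_sum_range_coinSize (d := d) fun _ => 1
  simp only [Finset.sum_const, Finset.card_range, smul_eq_mul, mul_one, one_mul] at h
  rw [h]
  have h2 := Finset.sum_range_reflect (fun i => 2 ^ i) (d + 1)
  simp only [Nat.add_sub_cancel] at h2
  rw [h2, Nat.geomSum_eq le_rfl, Nat.div_one, Nat.sub_add_cancel Nat.one_le_two_pow, pow_succ']

lemma sum_odd_mul_two_pow (d : ℕ) :
    ∑ i ∈ Finset.range (d + 1), (2 * i + 1) * 2 ^ (d - i) + 2 * d + 5 = 6 * 2 ^ d := by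
  induction d with
  | zero => simp
  | succ d ih =>
    rw [Finset.sum_range_succ]
    have : ∑ i ∈ Finset.range (d + 1), (2 * i + 1) * 2 ^ (d + 1 - i) =
        2 * ∑ i ∈ Finset.range (d + 1), (2 * i + 1) * 2 ^ (d - i) := by
      rw [Finset.mul_sum]
      refine Finset.sum_congr rfl fun i hi => ?_
      have : d + 1 - i = (d - i) + 1 := by
        have := Finset.mem_range.1 hi
        omega
      rw [this, pow_succ]
      ring
    rw [this]
    simp [pow_succ]
    omega

/-- The second moment of the truncated geometric sizes is at most `6`. -/
lemma sum_coinSize_sq_le : ∑ b : Fin d → Bool, coinSize b ^ 2 ≤ 6 * 2 ^ d := by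
  have h := sum_sum_range_coinSize (d := d) fun i => 2 * i + 1
  have hsq : ∀ n : ℕ, ∑ i ∈ Finset.range n, (2 * i + 1) = n ^ 2 := by
    intro n
    induction n with
    | zero => rfl
    | succ n ih => rw [Finset.sum_range_succ, ih]; ring
  simp only [hsq] at h
  rw [h]
  have := sum_odd_mul_two_pow d
  omega

/-- The size of a job that is not of the maximal size `d + 1`; jobs of maximal size count zero. -/
def smallSize (b : Fin d → Bool) : ℕ := if coinSize b ≤ d then coinSize b else 0

lemma smallSize_le (b : Fin d → Bool) : smallSize b ≤ coinSize b := by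
  unfold smallSize
  split_ifs <;> omega

lemma sum_smallSize : ∑ b : Fin d → Bool, smallSize b + (d + 2) = 2 * 2 ^ d := by
  have h : ∑ b : Fin d → Bool, coinSize b = ∑ b : Fin d → Bool, smallSize b + (d + 1) := by
    have : ∀ b : Fin d → Bool,
        coinSize b = smallSize b + if d < coinSize b then d + 1 else 0 := by
      intro b
      have := coinSize_le b
      unfold smallSize
      split_ifs <;> omega
    rw [Finset.sum_congr rfl fun b _ => this b, Finset.sum_add_distrib, ← Finset.sum_filter,
      Finset.sum_const, card_filter_coinSize_eq, one_smul]
  have := sum_coinSize (d := d)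
  omega

/-- Inverting the coin `k` prolongs a sequence of size `k + 1`. -/
lemma lt_coinSize_of_flip {b b' : Fin d → Bool} {k : ℕ} (hk : k < d) (hb : coinSize b = k + 1)
    (hb' : ∀ c, b' c = if c.val = k then !b c else b c) : k + 1 < coinSize b' := by
  have h1 := (lt_coinSize_iff b k).1 (by omega)
  have h2 : b ⟨k, hk⟩ = false := by
    by_contra hne
    have : k + 1 < coinSize b := (lt_coinSize_iff b (k + 1)).2 fun c hc => by
      rcases Nat.lt_succ_iff_lt_or_eq.1 hc with h | rfl
      · exact h1 c h
      · exact ⟨hk, by simpa using hne⟩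
    omega
  refine (lt_coinSize_iff b' (k + 1)).2 fun c hc => ?_
  rcases Nat.lt_succ_iff_lt_or_eq.1 hc with h | rfl
  · obtain ⟨hcd, e⟩ := h1 c h
    exact ⟨hcd, by rw [hb', if_neg (by simp; omega), e]⟩
  · exact ⟨hk, by rw [hb']; simp [h2]⟩

end Sizes

/-! ### Moments of sums of independent variables -/

section Moments

variable {α : Type*} [Fintype α]

/-- The mean of a sum of `N` identically distributed variables, as a sum over all outcomes. -/
lemma sum_pi_sum_apply (N : ℕ) (f : α → ℝ) :
    (Fintype.card α : ℝ) * ∑ ω : Fin N → α, ∑ j, f (ω j) =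
      (Fintype.card (Fin N → α) : ℝ) * (N * ∑ a, f a) := by
  classical
  rw [Finset.sum_comm]
  have key : ∀ j : Fin N, (Fintype.card α : ℝ) * ∑ ω : Fin N → α, f (ω j) =
      (Fintype.card (Fin N → α) : ℝ) * ∑ a, f a := by
    intro j
    obtain ⟨n, rfl⟩ : ∃ n, N = n + 1 := ⟨N - 1, by have := j.pos; omega⟩
    rw [← (Fin.insertNthEquiv (fun _ => α) j).sum_comp, Fintype.sum_prod_type]
    simp only [Fin.insertNthEquiv_apply, Fin.insertNth_apply_same, Finset.sum_const,
      Finset.card_univ, nsmul_eq_mul, Fintype.card_fun, Fintype.card_fin, Nat.cast_pow, Nat.cast_mul,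
      pow_succ, ← Finset.mul_sum]
    ring
  rw [Finset.mul_sum, Finset.sum_congr rfl fun j _ => key j]
  simp
  ring

/-- The second moment of a sum of `N` independent centred variables, as a sum over all outcomes. -/
lemma sum_pi_sq_sum_apply (N : ℕ) (f : α → ℝ) (hf : ∑ a, f a = 0) :
    (Fintype.card α : ℝ) * ∑ ω : Fin N → α, (∑ j, f (ω j)) ^ 2 =
      (Fintype.card (Fin N → α) : ℝ) * (N * ∑ a, f a ^ 2) := by
  classical
  induction N with
  | zero => simp
  | succ n ih =>
    rw [← (Fin.consEquiv fun _ => α).sum_comp, Fintype.sum_prod_type]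
    have : ∀ a : α, ∀ ω : Fin n → α, (∑ j, f ((Fin.consEquiv fun _ => α) (a, ω) j)) ^ 2 =
        f a ^ 2 + 2 * f a * ∑ j, f (ω j) + (∑ j, f (ω j)) ^ 2 := by
      intro a ω
      rw [Fin.sum_univ_succ]
      simp [Fin.consEquiv]
      ring
    simp only [this, Finset.sum_add_distrib, ← Finset.mul_sum, ← Finset.sum_mul, hf]
    simp only [Finset.sum_const, Finset.card_univ, nsmul_eq_mul, ← Finset.mul_sum]
    rw [mul_add, mul_left_comm (Fintype.card α : ℝ), ih]
    simp only [Fintype.card_fun, Fintype.card_fin, Nat.cast_pow, Nat.cast_add, Nat.cast_one,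
      Nat.cast_mul, pow_succ]
    ring

end Moments

/-! ### Unfinished jobs of an online algorithm on the random instance -/

section CoinInstance

variable {d N L T : ℕ}

/-- Release dates: `N` jobs at time `0`, then one job at each of the times `T, ..., T + L - 1`. -/
def coinRelease (N L T : ℕ) : Fin (N + L) → ℕ := Fin.addCases (fun _ => 0) fun i => T + i

/-- The sizes: those of the first `N` jobs are determined by coins, the later jobs have size one. -/
def coinLength (L : ℕ) (ω : Fin N → Fin d → Bool) : Fin (N + L) → ℕ :=
  Fin.addCases (fun j => coinSize (ω j)) fun _ => 1

@[simp] lemma coinRelease_castAdd (j : Fin N) : coinRelease N L T (Fin.castAdd L j) = 0 := by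
  simp [coinRelease]

@[simp] lemma coinRelease_natAdd (i : Fin L) : coinRelease N L T (Fin.natAdd N i) = T + i := by
  simp [coinRelease]

@[simp] lemma coinLength_castAdd (ω : Fin N → Fin d → Bool) (j : Fin N) :
    coinLength L ω (Fin.castAdd L j) = coinSize (ω j) := by
  simp [coinLength]

@[simp] lemma coinLength_natAdd (ω : Fin N → Fin d → Bool) (i : Fin L) :
    coinLength L ω (Fin.natAdd N i) = 1 := by
  simp [coinLength]

lemma one_le_coinLength (ω : Fin N → Fin d → Bool) (j : Fin (N + L)) : 1 ≤ coinLength L ω j := by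
  induction j using Fin.addCases with
  | left j => simpa using one_le_coinSize _
  | right i => simp

lemma coinLength_le (ω : Fin N → Fin d → Bool) (j : Fin (N + L)) : coinLength L ω j ≤ d + 1 := by
  induction j using Fin.addCases with
  | left j => simpa using coinSize_le _
  | right i => simp

/-- The hard instance with coins `ω`: `N` jobs of truncated geometric sizes, followed by a stream of
`L` unit jobs that starts at time `T`. -/
abbrev coinInstance (d N L T : ℕ) (ω : Fin N → Fin d → Bool) : JobInstance (d + 1) :=
  unitInstance d (N + L) (coinRelease N L T) (coinLength L ω) (one_le_coinLength ω)

@[simp] lemma size_coinInstance (ω : Fin N → Fin d → Bool) (j : Fin (N + L)) :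
    (coinInstance d N L T ω).size j = coinLength L ω j :=
  size_unitInstance (coinLength_le ω j)

/-- Invert the coin that decides whether the job `o`, processed when the jobs have received `y`,
continues afterwards. -/
def flipAt (o : Option (Fin (N + L))) (y : Fin (N + L) → ℕ) (ω : Fin N → Fin d → Bool) :
    Fin N → Fin d → Bool := fun j c =>
  if o = some (Fin.castAdd L j) ∧ c.val = y (Fin.castAdd L j) then !ω j c else ω j c

lemma flipAt_flipAt (o : Option (Fin (N + L))) (y : Fin (N + L) → ℕ) (ω : Fin N → Fin d → Bool) :
    flipAt o y (flipAt o y ω) = ω := by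
  funext j c
  unfold flipAt
  split_ifs <;> simp

/-- At time `t`, the algorithm completes one of the first `N` jobs, not of the maximal size. -/
def CompletesAt (A : OnlineAlgorithm) (L T t : ℕ) (ω : Fin N → Fin d → Bool) : Prop :=
  ∃ j : Fin N, (coinInstance d N L T ω).schedule A t = some (Fin.castAdd L j) ∧
    ((coinInstance d N L T ω).run A t).1 (Fin.castAdd L j) + 1 = coinSize (ω j) ∧ coinSize (ω j) ≤ d

/-- The coin that decides about completion at time `t` has not influenced the run before. -/
lemma CompletesAt.run_flipAt {A : OnlineAlgorithm} {t : ℕ} {ω : Fin N → Fin d → Bool}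
    (h : CompletesAt A L T t ω) {ω' : Fin N → Fin d → Bool}
    (hω' : ω' = flipAt ((coinInstance d N L T ω).schedule A t)
      ((coinInstance d N L T ω).run A t).1 ω) :
    (coinInstance d N L T ω).run A t = (coinInstance d N L T ω').run A t ∧
      (coinInstance d N L T ω).schedule A t = (coinInstance d N L T ω').schedule A t ∧
      ¬ CompletesAt A L T t ω' := by
  obtain ⟨j, hs, hy, hd⟩ := h
  set y := ((coinInstance d N L T ω).run A t).1 with hydef
  have hlt : y (Fin.castAdd L j) + 1 < coinSize (ω' j) := by
    refine lt_coinSize_of_flip (b := ω j) (by omega) hy.symm fun c => ?_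
    rw [hω', hs]
    simp [flipAt]
  have hne : ∀ i, i ≠ Fin.castAdd L j → coinLength L ω i = coinLength L ω' i := by
    intro i hi
    induction i using Fin.addCases with
    | left i =>
      have : ω' i = ω i := by
        funext c
        rw [hω', hs, flipAt, if_neg]
        rintro ⟨h, -⟩
        exact hi (Option.some_injective _ h).symm
      simp [this]
    | right i => simp
  have key := run_unitInstance_congr (hp := one_le_coinLength ω) (hp' := one_le_coinLength ω')
    (r := coinRelease N L T) A (coinLength_le ω) (coinLength_le ω')
    (k := y (Fin.castAdd L j) + 1) hne (by simp; omega) (by simp; omega) t (Nat.lt_succ_self _)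
  refine ⟨key.1, key.2, ?_⟩
  rintro ⟨i, hs', hy', -⟩
  rw [← key.2, hs] at hs'
  have hij : j = i := Fin.castAdd_injective _ _ (Option.some_injective _ hs')
  subst hij
  rw [← key.1] at hy'
  have hy'' : y (Fin.castAdd L j) + 1 = coinSize (ω' j) := hy'
  omega

open Classical in
/-- In every step, at most half of the coin sequences let the algorithm complete a job that is not
of the maximal size. -/
lemma two_mul_card_completesAt_le (A : OnlineAlgorithm) (t : ℕ) :
    2 * (Finset.univ.filter fun ω : Fin N → Fin d → Bool => CompletesAt A L T t ω).card ≤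
      Fintype.card (Fin N → Fin d → Bool) := by
  set E := Finset.univ.filter fun ω : Fin N → Fin d → Bool => CompletesAt A L T t ω with hE
  have hmem : ∀ {ω}, ω ∈ E ↔ CompletesAt A L T t ω := by simp [hE]
  have hle : E.card ≤ Eᶜ.card := by
    refine Finset.card_le_card_of_injOn
      (fun ω => flipAt ((coinInstance d N L T ω).schedule A t)
        ((coinInstance d N L T ω).run A t).1 ω) (fun ω hω => ?_) fun ω₁ h₁ ω₂ h₂ h => ?_
    · have := (CompletesAt.run_flipAt (hmem.1 hω) rfl).2.2
      simpa [hE] using this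
    · -- The flipped sequence determines the run, hence which coin was flipped.
      obtain ⟨ω', hω'⟩ : ∃ ω', ω' = flipAt ((coinInstance d N L T ω₁).schedule A t)
        ((coinInstance d N L T ω₁).run A t).1 ω₁ := ⟨_, rfl⟩
      have back : ∀ ω ∈ E, ω' = flipAt ((coinInstance d N L T ω).schedule A t)
          ((coinInstance d N L T ω).run A t).1 ω →
          ω = flipAt ((coinInstance d N L T ω').schedule A t)
            ((coinInstance d N L T ω').run A t).1 ω' := by
        intro ω hω e
        obtain ⟨hr, hs, -⟩ := CompletesAt.run_flipAt (hmem.1 hω) e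
        rw [← hr, ← hs, e, flipAt_flipAt]
      exact (back ω₁ h₁ hω').trans (back ω₂ h₂ (hω'.trans h)).symm
  have := Finset.card_add_card_compl E
  omega

/-- The number of jobs of the maximal size. -/
def numMax (ω : Fin N → Fin d → Bool) : ℕ := (Finset.univ.filter fun j => d < coinSize (ω j)).card

open Classical in
lemma card_completed_le (A : OnlineAlgorithm) (ω : Fin N → Fin d → Bool) (t : ℕ) :
    (Finset.univ.filter fun j : Fin N => coinSize (ω j) ≤ d ∧
      coinSize (ω j) ≤ ((coinInstance d N L T ω).run A t).1 (Fin.castAdd L j)).card ≤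
    ((Finset.range t).filter fun s => CompletesAt A L T s ω).card := by
  induction t with
  | zero =>
    have : ∀ j, ¬ coinSize (ω j) ≤ 0 := fun j => by
      have := one_le_coinSize (ω j)
      omega
    simp [JobInstance.run, this]
  | succ t ih =>
    have hrun : ∀ j, ((coinInstance d N L T ω).run A (t + 1)).1 j =
        ((coinInstance d N L T ω).run A t).1 j +
          if (coinInstance d N L T ω).schedule A t = some j then 1 else 0 := fun j => rfl
    rw [Finset.range_add_one, Finset.filter_insert]
    by_cases hC : CompletesAt A L T t ω
    · rw [if_pos hC, Finset.card_insert_of_notMem (by simp)]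
      obtain ⟨j₀, hs, -⟩ := hC
      refine le_trans ?_ (Nat.succ_le_succ ih)
      refine le_trans (Finset.card_le_card (t := insert j₀ _) fun j hj => ?_)
        (Finset.card_insert_le j₀ _)
      simp only [Finset.mem_insert, Finset.mem_filter, Finset.mem_univ, true_and, hrun, hs] at hj ⊢
      by_cases h : j = j₀
      · exact Or.inl h
      · rw [if_neg fun e => h (Fin.castAdd_injective _ _ (Option.some_injective _ e)).symm] at hj
        exact Or.inr hj
    · rw [if_neg hC]
      refine le_trans (Finset.card_le_card fun j hj => ?_) ih
      simp only [Finset.mem_filter, Finset.mem_univ, true_and, hrun] at hj ⊢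
      refine ⟨hj.1, ?_⟩
      by_contra hlt
      have hj2 := hj.2
      split_ifs at hj2 with hs
      · exact hC ⟨j, hs, by omega, hj.1⟩
      · omega

/-- At time `T`, the unit job that has just arrived and all jobs not yet completed are unfinished. -/
lemma add_one_le_card_alive (A : OnlineAlgorithm) (hL : 1 ≤ L) (ω : Fin N → Fin d → Bool) :
    N + 1 ≤ ((coinInstance d N L T ω).alive ((coinInstance d N L T ω).schedule A) T).card +
      (Finset.univ.filter fun j : Fin N => coinSize (ω j) ≤ d ∧
        coinSize (ω j) ≤ ((coinInstance d N L T ω).run A T).1 (Fin.castAdd L j)).card +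
      numMax ω := by
  classical
  set S := Finset.univ.filter fun j : Fin N => coinSize (ω j) ≤ d ∧
        coinSize (ω j) ≤ ((coinInstance d N L T ω).run A T).1 (Fin.castAdd L j) with hS
  set B := Finset.univ.filter fun j => d < coinSize (ω j) with hB
  set R := (S ∪ B)ᶜ with hR
  have h1 : insert (Fin.natAdd N ⟨0, hL⟩) (R.map (Fin.castAddEmb L)) ⊆
      (coinInstance d N L T ω).alive ((coinInstance d N L T ω).schedule A) T := by
    intro i hi
    rw [JobInstance.mem_alive, size_coinInstance]
    rcases Finset.mem_insert.1 hi with rfl | hi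
    · have hrel := coinRelease_natAdd (N := N) (T := T) ⟨0, hL⟩
      refine ⟨hrel.le, ?_⟩
      rw [(JobInstance.feasible_schedule _ A).processed_eq_zero hrel.ge, coinLength_natAdd]
      exact Nat.one_pos
    · obtain ⟨j, hj, rfl⟩ := Finset.mem_map.1 hi
      refine ⟨by simp, ?_⟩
      rw [← JobInstance.run_fst_eq_processed]
      simp only [hR, hS, hB, Finset.mem_compl, Finset.mem_union, Finset.mem_filter, Finset.mem_univ,
        true_and] at hj
      simp
      omega
  have h2 := Finset.card_le_card h1
  rw [Finset.card_insert_of_notMem, Finset.card_map] at h2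
  · have h3 := Finset.card_add_card_compl (S ∪ B)
    have h4 := Finset.card_union_le S B
    rw [Fintype.card_fin] at h3
    have h5 : numMax ω = B.card := rfl
    rw [← hR] at h3
    omega
  · intro h
    obtain ⟨j, -, hj⟩ := Finset.mem_map.1 h
    have := congrArg Fin.val hj
    simp at this
    omega

/-- From time `T` on, the algorithm never has fewer unfinished jobs than at time `T`, as long as the
stream of unit jobs lasts. -/
lemma mul_card_alive_le_cost (A : OnlineAlgorithm) (ω : Fin N → Fin d → Bool) :
    ((L * ((coinInstance d N L T ω).alive ((coinInstance d N L T ω).schedule A) T).card : ℕ) : ℕ∞) ≤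
      (coinInstance d N L T ω).cost A := by
  refine le_trans ?_ (JobInstance.sum_card_alive_le_totalFlow _ _ (Finset.Ico T (T + L)))
  have key : ∀ i < L, ((coinInstance d N L T ω).alive ((coinInstance d N L T ω).schedule A) T).card ≤
      ((coinInstance d N L T ω).alive ((coinInstance d N L T ω).schedule A) (T + i)).card := by
    intro i hi
    induction i with
    | zero => exact le_rfl
    | succ i ih =>
      refine (ih (by omega)).trans ?_
      exact (JobInstance.feasible_schedule _ A).card_alive_le_succ (j₀ := Fin.natAdd N ⟨i + 1, hi⟩)
        (coinRelease_natAdd _)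
  have h := Finset.card_nsmul_le_sum (Finset.Ico T (T + L))
    (fun t => ((coinInstance d N L T ω).alive ((coinInstance d N L T ω).schedule A) t).card) _
    fun t ht => by
      obtain ⟨i, rfl⟩ := Nat.exists_eq_add_of_le (Finset.mem_Ico.1 ht).1
      exact key i (by have := (Finset.mem_Ico.1 ht).2; omega)
  rw [Nat.card_Ico, Nat.add_sub_cancel_left, smul_eq_mul] at h
  exact_mod_cast h

lemma two_pow_mul_sum_numMax :
    2 ^ d * ∑ ω : Fin N → Fin d → Bool, numMax ω = Fintype.card (Fin N → Fin d → Bool) * N := by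
  have h := sum_pi_sum_apply (α := Fin d → Bool) N fun b => if d < coinSize b then 1 else 0
  have h1 : ∀ ω : Fin N → Fin d → Bool,
      ((numMax ω : ℕ) : ℝ) = ∑ j, if d < coinSize (ω j) then 1 else 0 := by
    intro ω
    simp [numMax]
  have h2 : ∑ b : Fin d → Bool, (if d < coinSize b then (1 : ℝ) else 0) = 1 := by
    rw [Finset.sum_boole, card_filter_coinSize_eq, Nat.cast_one]
  simp only [← h1, h2] at h
  have h3 : Fintype.card (Fin d → Bool) = 2 ^ d := by simp
  rw [h3, mul_one] at h
  exact_mod_cast h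

/-- Averaged over the coins, the number of unfinished jobs of a deterministic algorithm at time `T`
is at least `N + 1 - T / 2 - N / 2 ^ d`. -/
lemma le_sum_card_alive (A : OnlineAlgorithm) (hL : 1 ≤ L) :
    2 * (Fintype.card (Fin N → Fin d → Bool) * (N + 1)) ≤
      2 * ∑ ω : Fin N → Fin d → Bool,
        ((coinInstance d N L T ω).alive ((coinInstance d N L T ω).schedule A) T).card +
      T * Fintype.card (Fin N → Fin d → Bool) + 2 * ∑ ω : Fin N → Fin d → Bool, numMax ω := by
  classical
  have h1 := Finset.sum_le_sum fun (ω : Fin N → Fin d → Bool) (_ : ω ∈ Finset.univ) =>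
    (add_one_le_card_alive (T := T) A hL ω).trans
      (Nat.add_le_add_right (Nat.add_le_add_left (card_completed_le A ω T) _) _)
  rw [Finset.sum_const, Finset.card_univ, smul_eq_mul, Finset.sum_add_distrib,
    Finset.sum_add_distrib] at h1
  have h2 : ∑ ω : Fin N → Fin d → Bool,
      ((Finset.range T).filter fun s => CompletesAt A L T s ω).card =
      ∑ s ∈ Finset.range T,
        (Finset.univ.filter fun ω : Fin N → Fin d → Bool => CompletesAt A L T s ω).card := by
    simp only [Finset.card_eq_sum_ones, Finset.sum_filter]
    exact Finset.sum_comm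
  have h3 := Finset.sum_le_sum fun s (_ : s ∈ Finset.range T) =>
    two_mul_card_completesAt_le (N := N) (d := d) (L := L) (T := T) A s
  rw [← Finset.mul_sum, Finset.sum_const, Finset.card_range, smul_eq_mul] at h3
  rw [h2] at h1
  omega

end CoinInstance

/-! ### Upper bound on the optimum -/

section Opt

variable {d N L T : ℕ}

/-- The unit pieces of the jobs in `S`, in some order. -/
noncomputable def pieces (ω : Fin N → Fin d → Bool) (S : Finset (Fin N)) : List (Fin N) :=
  (∑ j ∈ S, Multiset.replicate (coinSize (ω j)) j).toList

lemma length_pieces (ω : Fin N → Fin d → Bool) (S : Finset (Fin N)) :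
    (pieces ω S).length = ∑ j ∈ S, coinSize (ω j) := by
  simp [pieces]

lemma count_pieces (ω : Fin N → Fin d → Bool) (S : Finset (Fin N)) (j : Fin N) :
    (pieces ω S).count j = if j ∈ S then coinSize (ω j) else 0 := by
  rw [pieces, ← Multiset.coe_count, Multiset.coe_toList, Multiset.count_sum']
  simp [Multiset.count_replicate]

/-- The schedule that processes the pieces in `l` in their order, interrupted by the stream of unit
jobs during `[T, T + L]`. -/
def listSchedule (L T : ℕ) (l : List (Fin N)) (t : ℕ) : Option (Fin (N + L)) :=
  if t < T then l[t]?.map (Fin.castAdd L)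
  else if h : t - T < L then some (Fin.natAdd N ⟨t - T, h⟩)
  else l[t - L]?.map (Fin.castAdd L)

lemma map_castAdd_eq_some {o : Option (Fin N)} {j : Fin N} :
    o.map (Fin.castAdd L) = some (Fin.castAdd L j) ↔ o = some j := by
  rcases o with _ | i
  · simp
  · simp

lemma map_castAdd_ne_natAdd {o : Option (Fin N)} {i : Fin L} :
    o.map (Fin.castAdd L) ≠ some (Fin.natAdd N i) := by
  rcases o with _ | j
  · simp
  · intro h
    have := congrArg Fin.val (Option.some_injective _ h)
    simp at this
    omega

lemma count_take_succ (l : List (Fin N)) (j : Fin N) (u : ℕ) :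
    (l.take (u + 1)).count j = (l.take u).count j + if l[u]? = some j then 1 else 0 := by
  rw [List.take_add_one, List.count_append]
  congr 1
  rcases l[u]? with _ | i
  · simp
  · simp [List.count_singleton]

lemma processed_listSchedule_castAdd (ω : Fin N → Fin d → Bool) (l : List (Fin N)) (j : Fin N)
    (t : ℕ) :
    (coinInstance d N L T ω).processed (listSchedule L T l) (Fin.castAdd L j) t =
      (l.take (min t T + (t - (T + L)))).count j := by
  induction t with
  | zero => simp [JobInstance.processed_zero]
  | succ t ih =>
    rw [JobInstance.processed_succ, ih, listSchedule]
    split_ifs with h1 h2 h3 h4 h5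
    · rw [map_castAdd_eq_some] at h2
      rw [show min t T + (t - (T + L)) = t by omega,
        show min (t + 1) T + (t + 1 - (T + L)) = t + 1 by omega, count_take_succ, if_pos h2]
    · rw [map_castAdd_eq_some] at h2
      rw [show min t T + (t - (T + L)) = t by omega,
        show min (t + 1) T + (t + 1 - (T + L)) = t + 1 by omega, count_take_succ, if_neg h2]
    · have := congrArg Fin.val (Option.some_injective _ h4)
      simp at this
      omega
    · rw [show min (t + 1) T + (t + 1 - (T + L)) = min t T + (t - (T + L)) by omega, add_zero]
    · rw [map_castAdd_eq_some] at h5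
      rw [show min t T + (t - (T + L)) = t - L by omega,
        show min (t + 1) T + (t + 1 - (T + L)) = t - L + 1 by omega, count_take_succ, if_pos h5]
    · rw [map_castAdd_eq_some] at h5
      rw [show min t T + (t - (T + L)) = t - L by omega,
        show min (t + 1) T + (t + 1 - (T + L)) = t - L + 1 by omega, count_take_succ, if_neg h5]

lemma processed_listSchedule_natAdd (ω : Fin N → Fin d → Bool) (l : List (Fin N)) (i : Fin L)
    (t : ℕ) :
    (coinInstance d N L T ω).processed (listSchedule L T l) (Fin.natAdd N i) t =
      if T + i < t then 1 else 0 := by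
  have hiff : ∀ t, listSchedule L T l t = some (Fin.natAdd N i) ↔ t = T + i := by
    intro t
    have := i.isLt
    unfold listSchedule
    split_ifs with h1 h2
    · simp only [map_castAdd_ne_natAdd, false_iff]
      omega
    · rw [Option.some_inj, Fin.ext_iff]
      simp
      omega
    · simp only [map_castAdd_ne_natAdd, false_iff]
      omega
  induction t with
  | zero => simp [JobInstance.processed_zero]
  | succ t ih =>
    rw [JobInstance.processed_succ, ih]
    simp only [hiff]
    split_ifs <;> omega

lemma feasible_listSchedule (ω : Fin N → Fin d → Bool) {l : List (Fin N)}
    (hl : ∀ j, l.count j = coinSize (ω j)) :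
    (coinInstance d N L T ω).Feasible (listSchedule L T l) := by
  intro t x hx
  induction x using Fin.addCases with
  | left j =>
    refine ⟨by simp, ?_⟩
    rw [size_coinInstance, coinLength_castAdd, ← hl j]
    have h1 := JobInstance.processed_succ (coinInstance d N L T ω) (listSchedule L T l)
      (Fin.castAdd L j) t
    rw [if_pos hx, processed_listSchedule_castAdd, processed_listSchedule_castAdd] at h1
    have h2 := (List.take_sublist (min (t + 1) T + (t + 1 - (T + L))) l).count_le j
    rw [processed_listSchedule_castAdd]
    omega
  | right i =>
    have h1 := JobInstance.processed_succ (coinInstance d N L T ω) (listSchedule L T l)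
      (Fin.natAdd N i) t
    rw [if_pos hx, processed_listSchedule_natAdd, processed_listSchedule_natAdd] at h1
    rw [size_coinInstance, coinLength_natAdd, processed_listSchedule_natAdd]
    have : T + i ≤ t ∧ ¬ T + i < t := by split_ifs at h1 <;> omega
    exact ⟨(coinRelease_natAdd i).le.trans this.1, by rw [if_neg this.2]; exact Nat.one_pos⟩

/-- Processing the short jobs first, the optimum has few unfinished jobs while the stream of unit
jobs lasts: those of the maximal size, and one for each unit of work on short jobs exceeding `T`. -/
lemma opt_coinInstance_le (ω : Fin N → Fin d → Bool) :
    (coinInstance d N L T ω).opt ≤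
      ((N * T + L + N * (N * (d + 1)) + L * (numMax ω + (∑ j, smallSize (ω j) - T)) : ℕ) : ℕ∞) := by
  classical
  set l₁ := pieces ω (Finset.univ.filter fun j => coinSize (ω j) ≤ d) with hl₁
  set l₂ := pieces ω (Finset.univ.filter fun j => d < coinSize (ω j)) with hl₂
  set l := l₁ ++ l₂ with hl
  have hcount : ∀ j, l.count j = coinSize (ω j) := by
    intro j
    rw [hl, List.count_append, count_pieces, count_pieces]
    by_cases h : coinSize (ω j) ≤ d
    · simp [h, Nat.not_lt.2 h]
    · simp [h, Nat.not_le.1 h]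
  have hlen₁ : l₁.length = ∑ j, smallSize (ω j) := by
    rw [hl₁, length_pieces, Finset.sum_filter]
    rfl
  have hlen : l.length ≤ N * (d + 1) := by
    have : l.length = ∑ j, coinSize (ω j) := by
      rw [hl, List.length_append, hl₁, hl₂, length_pieces, length_pieces]
      simp only [← not_le]
      exact Finset.sum_filter_add_sum_filter_not _ _ _
    rw [this]
    refine (Finset.sum_le_sum fun j _ => coinSize_le (ω j)).trans ?_
    simp
  -- The jobs that are not completed at time `T`
  set D := (l.drop T).toFinset with hD
  have hDcard : D.card ≤ numMax ω + (∑ j, smallSize (ω j) - T) := by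
    have hsub : D ⊆ (Finset.univ.filter fun j => d < coinSize (ω j)) ∪ (l₁.drop T).toFinset := by
      intro j hj
      rw [hD, List.mem_toFinset, hl, List.drop_append, List.mem_append] at hj
      rw [Finset.mem_union, List.mem_toFinset]
      refine hj.symm.imp (fun h => ?_) id
      have h2 := List.count_pos_iff.2 (List.mem_of_mem_drop h)
      rw [hl₂, count_pieces] at h2
      by_contra hne
      rw [if_neg hne] at h2
      exact lt_irrefl _ h2
    refine (Finset.card_le_card hsub).trans ((Finset.card_union_le _ _).trans ?_)
    refine Nat.add_le_add_left ((List.toFinset_card_le _).trans ?_) _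
    rw [List.length_drop, hlen₁]
  have hDN : D.card ≤ N := by simpa using Finset.card_le_univ D
  refine (iInf₂_le (listSchedule L T l) (feasible_listSchedule ω hcount)).trans ?_
  have hcomp : ∀ (x : Fin (N + L)) (t : ℕ), (coinInstance d N L T ω).size x ≤
      (coinInstance d N L T ω).processed (listSchedule L T l) x t →
      (coinInstance d N L T ω).completionTime (listSchedule L T l) x -
        ((coinInstance d N L T ω).release x : ℕ∞) ≤ ((t - coinRelease N L T x : ℕ) : ℕ∞) := by
    intro x t h
    rw [ENat.natCast_sub]
    exact tsub_le_tsub_right (iInf₂_le t h) _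
  have hflow : (coinInstance d N L T ω).totalFlow (listSchedule L T l) ≤
      ∑ x : Fin (N + L), ((Fin.addCases (motive := fun _ => ℕ)
        (fun j => T + if j ∈ D then L + l.length else 0) (fun _ => 1) x : ℕ) : ℕ∞) := by
    refine Finset.sum_le_sum fun x _ => ?_
    induction x using Fin.addCases with
    | left j =>
      simp only [Fin.addCases_left]
      split_ifs with hj
      · refine (hcomp _ (T + (L + l.length)) ?_).trans (by simp)
        rw [size_coinInstance, coinLength_castAdd, processed_listSchedule_castAdd,
          List.take_of_length_le (by omega), hcount]
      · refine (hcomp _ T ?_).trans (by simp)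
        rw [size_coinInstance, coinLength_castAdd, processed_listSchedule_castAdd, ← hcount j,
          show min T T + (T - (T + L)) = T by omega]
        have h1 : (l.take T ++ l.drop T).count j = l.count j := by rw [List.take_append_drop]
        have h2 : (l.drop T).count j = 0 := List.count_eq_zero.2 fun h =>
          hj (List.mem_toFinset.2 h)
        rw [List.count_append] at h1
        omega
    | right i =>
      simp only [Fin.addCases_right]
      refine (hcomp _ (T + i + 1) ?_).trans ?_
      · rw [size_coinInstance, coinLength_natAdd, processed_listSchedule_natAdd, if_pos (by omega)]
      · rw [coinRelease_natAdd, Nat.add_sub_cancel_left]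
  refine hflow.trans ?_
  rw [← Nat.cast_sum, Fin.sum_univ_add]
  simp only [Fin.addCases_left, Fin.addCases_right]
  rw [Finset.sum_add_distrib, ← Finset.sum_filter, Finset.filter_mem_eq_inter, Finset.univ_inter]
  simp only [Finset.sum_const, Finset.card_univ, Fintype.card_fin, smul_eq_mul, mul_one]
  rw [Nat.cast_le]
  have h1 := Nat.mul_le_mul_left L hDcard
  have h2 := Nat.mul_le_mul hDN hlen
  rw [mul_add, mul_comm D.card L]
  omega

end Opt

/-! ### Averages over the instances -/

section Averaging

variable {d : ℕ}

/-- With `4 ^ d` random jobs, the work on the short ones exceeds its mean by `O(2 ^ d)` on average: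
its variance is `O(4 ^ d)`. -/
lemma sum_excess_le :
    2 * ∑ ω : Fin (2 ^ d * 2 ^ d) → Fin d → Bool,
        (∑ j, smallSize (ω j) - 2 ^ d * ∑ b : Fin d → Bool, smallSize b) ≤
      7 * 2 ^ d * Fintype.card (Fin (2 ^ d * 2 ^ d) → Fin d → Bool) := by
  set S := ∑ b : Fin d → Bool, smallSize b with hS
  set N := 2 ^ d * 2 ^ d with hN
  set C := Fintype.card (Fin N → Fin d → Bool) with hC
  obtain ⟨M, hM⟩ : ∃ M : ℝ, M = 2 ^ d := ⟨_, rfl⟩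
  have hM0 : 0 < M := by rw [hM]; positivity
  have hcard : ((Fintype.card (Fin d → Bool) : ℕ) : ℝ) = M := by simp [hM]
  have hNM : (N : ℝ) = M * M := by simp [hN, hM]
  have hS' : ∑ b : Fin d → Bool, (smallSize b : ℝ) = S := by simp [hS]
  set f : (Fin d → Bool) → ℝ := fun b => smallSize b - S / M with hf
  have hsum : ∑ b, f b = 0 := by
    simp only [hf, Finset.sum_sub_distrib, hS', Finset.sum_const, Finset.card_univ, nsmul_eq_mul,
      hcard]
    field_simp
    ring
  have hsq : ∑ b, f b ^ 2 ≤ 6 * M := by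
    have h1 : ∑ b, f b ^ 2 = ∑ b : Fin d → Bool, (smallSize b : ℝ) ^ 2 - S ^ 2 / M := by
      have : ∀ b, f b ^ 2 = (smallSize b : ℝ) ^ 2 - 2 * (S / M) * smallSize b + (S / M) ^ 2 := by
        intro b
        simp only [hf]
        ring
      simp only [this, Finset.sum_add_distrib, Finset.sum_sub_distrib, ← Finset.mul_sum, hS',
        Finset.sum_const, Finset.card_univ, nsmul_eq_mul, hcard]
      field_simp
      ring
    have h2 : ∑ b : Fin d → Bool, (smallSize b : ℝ) ^ 2 ≤ 6 * M := by
      rw [hM]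
      refine le_trans (Finset.sum_le_sum fun b _ => ?_)
        (by exact_mod_cast sum_coinSize_sq_le (d := d) :
          ∑ b : Fin d → Bool, (coinSize b : ℝ) ^ 2 ≤ 6 * 2 ^ d)
      have := smallSize_le b
      gcongr
    have h3 : 0 ≤ (S : ℝ) ^ 2 / M := by positivity
    linarith
  have hmom := sum_pi_sq_sum_apply N f hsum
  rw [hcard, hNM, ← hC] at hmom
  have hZ : ∑ ω : Fin N → Fin d → Bool, (∑ j, f (ω j)) ^ 2 ≤ 6 * M ^ 2 * C := by
    refine le_of_mul_le_mul_left ?_ hM0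
    rw [hmom]
    have : (C : ℝ) * (M * M * ∑ b, f b ^ 2) ≤ C * (M * M * (6 * M)) := by gcongr
    linarith
  -- The positive part `z` of the deviation satisfies `2 * M * z ≤ z ^ 2 + M ^ 2`.
  have hpt : ∀ ω : Fin N → Fin d → Bool,
      2 * M * ((∑ j, smallSize (ω j) - 2 ^ d * S : ℕ) : ℝ) ≤ (∑ j, f (ω j)) ^ 2 + M ^ 2 := by
    intro ω
    rcases le_total (∑ j, smallSize (ω j)) (2 ^ d * S) with h | h
    · rw [Nat.sub_eq_zero_of_le h]
      simp only [Nat.cast_zero, mul_zero]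
      positivity
    · have : ((∑ j, smallSize (ω j) - 2 ^ d * S : ℕ) : ℝ) = ∑ j, f (ω j) := by
        rw [Nat.cast_sub h]
        simp only [hf, Finset.sum_sub_distrib, Finset.sum_const, Finset.card_univ, nsmul_eq_mul,
          Fintype.card_fin, hNM]
        push_cast
        rw [← hM]
        field_simp
      rw [this]
      linarith [sq_nonneg (∑ j, f (ω j) - M)]
  have htot := Finset.sum_le_sum fun ω (_ : ω ∈ Finset.univ) => hpt ω
  rw [← Finset.mul_sum, Finset.sum_add_distrib, Finset.sum_const, Finset.card_univ, nsmul_eq_mul,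
    ← hC] at htot
  have hfin : 2 * ∑ ω : Fin N → Fin d → Bool, ((∑ j, smallSize (ω j) - 2 ^ d * S : ℕ) : ℝ) ≤
      7 * M * C := by
    refine le_of_mul_le_mul_left ?_ hM0
    linarith
  rw [hM] at hfin
  exact_mod_cast hfin

/-- The length of the stream of unit jobs: it makes the cost outside of the stream negligible. -/
def streamLength (d : ℕ) : ℕ :=
  2 ^ d * 2 ^ d * (2 ^ d * ∑ b : Fin d → Bool, smallSize b) +
    2 ^ d * 2 ^ d * (2 ^ d * 2 ^ d * (d + 1))

lemma one_le_streamLength : 1 ≤ streamLength d :=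
  Nat.one_le_iff_ne_zero.2 (by simp [streamLength])

/-- The hard random instance: `4 ^ d` jobs with truncated geometric sizes, and a stream of unit jobs
from the time on at which the expected work on the short jobs can be finished. -/
abbrev hardInstance (ω : Fin (2 ^ d * 2 ^ d) → Fin d → Bool) : JobInstance (d + 1) :=
  coinInstance d (2 ^ d * 2 ^ d) (streamLength d) (2 ^ d * ∑ b : Fin d → Bool, smallSize b) ω

lemma sum_numMax : ∑ ω : Fin (2 ^ d * 2 ^ d) → Fin d → Bool, numMax ω =
    Fintype.card (Fin (2 ^ d * 2 ^ d) → Fin d → Bool) * 2 ^ d := by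
  have h := two_pow_mul_sum_numMax (d := d) (N := 2 ^ d * 2 ^ d)
  refine Nat.eq_of_mul_eq_mul_left (Nat.two_pow_pos d) ?_
  rw [h]
  ring

/-- The optimum is on average at most `6.5 * 2 ^ d` per unit job of the stream. -/
lemma sum_opt_hardInstance_le :
    2 * ∑ ω : Fin (2 ^ d * 2 ^ d) → Fin d → Bool, (hardInstance ω).opt ≤
      ((13 * (streamLength d * Fintype.card (Fin (2 ^ d * 2 ^ d) → Fin d → Bool) * 2 ^ d) : ℕ) :
        ℕ∞) := by
  have h1 := Finset.sum_le_sum fun (ω : Fin (2 ^ d * 2 ^ d) → Fin d → Bool) (_ : ω ∈ Finset.univ) =>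
    opt_coinInstance_le (L := streamLength d) (T := 2 ^ d * ∑ b : Fin d → Bool, smallSize b) ω
  refine (mul_le_mul_right h1 2).trans ?_
  rw [← Nat.cast_sum]
  norm_cast
  have h2 := sum_excess_le (d := d)
  have h3 := sum_numMax (d := d)
  rw [Finset.sum_add_distrib, Finset.sum_const, Finset.card_univ, smul_eq_mul, ← Finset.mul_sum,
    Finset.sum_add_distrib, h3]
  have h4 : 2 ^ d * 2 ^ d * (2 ^ d * ∑ b : Fin d → Bool, smallSize b) + streamLength d +
      2 ^ d * 2 ^ d * (2 ^ d * 2 ^ d * (d + 1)) = 2 * streamLength d := by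
    unfold streamLength
    ring
  rw [h4]
  generalize Fintype.card (Fin (2 ^ d * 2 ^ d) → Fin d → Bool) = C at *
  generalize ∑ ω : Fin (2 ^ d * 2 ^ d) → Fin d → Bool,
    (∑ j, smallSize (ω j) - 2 ^ d * ∑ b : Fin d → Bool, smallSize b) = e at *
  have h5 : 1 ≤ 2 ^ d := Nat.one_le_two_pow
  generalize 2 ^ d = M at *
  generalize streamLength d = L at *
  calc 2 * (C * (2 * L) + L * (C * M + e)) = 4 * (L * C) * 1 + 2 * (L * C * M) + L * (2 * e) := by
        ring
    _ ≤ 4 * (L * C) * M + 2 * (L * C * M) + L * (7 * M * C) := by gcongr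
    _ = 13 * (L * C * M) := by ring

/-- The number of jobs that `A` has not finished when the stream of unit jobs starts. -/
def numAlive (A : OnlineAlgorithm) (ω : Fin (2 ^ d * 2 ^ d) → Fin d → Bool) : ℕ :=
  ((hardInstance ω).alive ((hardInstance ω).schedule A)
    (2 ^ d * ∑ b : Fin d → Bool, smallSize b)).card

/-- A deterministic algorithm has on average at least `1 + 2 ^ d * d / 2` unfinished jobs. -/
lemma le_sum_numAlive (A : OnlineAlgorithm) :
    Fintype.card (Fin (2 ^ d * 2 ^ d) → Fin d → Bool) * (2 + 2 ^ d * d) ≤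
      2 * ∑ ω : Fin (2 ^ d * 2 ^ d) → Fin d → Bool, numAlive A ω := by
  have h1 := le_sum_card_alive (d := d) (N := 2 ^ d * 2 ^ d) (L := streamLength d)
    (T := 2 ^ d * ∑ b : Fin d → Bool, smallSize b) A one_le_streamLength
  rw [sum_numMax] at h1
  change _ ≤ 2 * ∑ ω, numAlive A ω + _ + _ at h1
  have h2 := sum_smallSize (d := d)
  generalize ∑ b : Fin d → Bool, smallSize b = S at *
  generalize Fintype.card (Fin (2 ^ d * 2 ^ d) → Fin d → Bool) = C at *
  generalize ∑ ω : Fin (2 ^ d * 2 ^ d) → Fin d → Bool, numAlive A ω = a at *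
  generalize 2 ^ d = M at *
  zify at *
  have h3 : (S : ℤ) = 2 * M - (d + 2) := by linarith
  rw [h3] at h1
  linarith

end Averaging

/-! ### Measurability of the run of a randomized algorithm -/

section Measurability

variable {Ω : Type*} [MeasurableSpace Ω]

instance : Countable JobView :=
  Function.Injective.countable
    (f := fun v : JobView => (v.label, v.release, v.processed, v.revealed)) fun v w h => by
      cases v
      cases w
      simp_all

/-- The state reached by a randomized algorithm at time `t` is a discrete random variable. -/
lemma measurableSet_run_eq {m : ℕ} (I : JobInstance m) (A : RandomizedAlgorithm Ω) (t : ℕ)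
    (s : (Fin I.n → ℕ) × List Observation) :
    MeasurableSet {ω | I.run (A.toAlgorithm ω) t = s} := by
  induction t generalizing s with
  | zero => exact MeasurableSet.const (((fun _ => 0), []) = s)
  | succ t ih =>
    have : {ω | I.run (A.toAlgorithm ω) (t + 1) = s} =
        ⋃ (s₀ : (Fin I.n → ℕ) × List Observation) (c : Option ℕ),
          {ω | I.run (A.toAlgorithm ω) t = s₀} ∩
            {ω | A.toAlgorithm ω (s₀.2 ++ [I.observe t s₀.1]) = c} ∩
            {_ω | ((fun j => s₀.1 j + if I.select t s₀.1 c = some j then 1 else 0),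
              s₀.2 ++ [I.observe t s₀.1]) = s} := by
      ext ω
      simp only [Set.mem_iUnion, Set.mem_inter_iff, Set.mem_ofPred_eq]
      constructor
      · intro h
        exact ⟨_, _, ⟨rfl, rfl⟩, h⟩
      · rintro ⟨s₀, c, ⟨rfl, rfl⟩, h⟩
        exact h
    rw [this]
    exact MeasurableSet.iUnion fun s₀ => MeasurableSet.iUnion fun c =>
      ((ih s₀).inter (A.measurable_decision _ c)).inter (MeasurableSet.const _)

lemma measurable_numAlive {d : ℕ} (A : RandomizedAlgorithm Ω)
    (η : Fin (2 ^ d * 2 ^ d) → Fin d → Bool) :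
    Measurable fun ω => numAlive (A.toAlgorithm ω) η := by
  set T := 2 ^ d * ∑ b : Fin d → Bool, smallSize b with hT
  let _ : MeasurableSpace ((Fin (hardInstance η).n → ℕ) × List Observation) := ⊤
  have hrun : Measurable fun ω => (hardInstance η).run (A.toAlgorithm ω) T :=
    measurable_to_countable' fun s => measurableSet_run_eq _ A T s
  have : (fun ω => numAlive (A.toAlgorithm ω) η) =
      (fun s : (Fin (hardInstance η).n → ℕ) × List Observation =>
        (Finset.univ.filter fun j => (hardInstance η).release j ≤ T ∧
          s.1 j < (hardInstance η).size j).card) ∘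
        fun ω => (hardInstance η).run (A.toAlgorithm ω) T := by
    funext ω
    simp only [numAlive, JobInstance.alive, Function.comp, JobInstance.run_fst_eq_processed]
    rfl
  rw [this]
  exact measurable_from_top.comp hrun

end Measurability

/-! ### The competitive ratio -/

/-- Averaging over the coins of the instance and over those of the algorithm. -/
lemma IsCompetitive.mul_le {Ω : Type*} [MeasurableSpace Ω] {P : Measure Ω} [IsProbabilityMeasure P]
    {A : RandomizedAlgorithm Ω} {d : ℕ} {ρ : ℝ≥0∞} (h : IsCompetitive P A (d + 1) ρ) :
    ((2 + 2 ^ d * d : ℕ) : ℝ≥0∞) ≤ ρ * ((13 * 2 ^ d : ℕ) : ℝ≥0∞) := by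
  set C := Fintype.card (Fin (2 ^ d * 2 ^ d) → Fin d → Bool) with hC
  set L := streamLength d with hL
  have hL0 : L * C ≠ 0 := mul_ne_zero (Nat.one_le_iff_ne_zero.1 one_le_streamLength)
    Fintype.card_ne_zero
  have halg : ((L * C * (2 + 2 ^ d * d) : ℕ) : ℝ≥0∞) ≤
      2 * ∑ η : Fin (2 ^ d * 2 ^ d) → Fin d → Bool,
        ∫⁻ ω, ((hardInstance η).cost (A.toAlgorithm ω) : ℝ≥0∞) ∂P := by
    calc ((L * C * (2 + 2 ^ d * d) : ℕ) : ℝ≥0∞)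
        = ∫⁻ _ω, ((L * C * (2 + 2 ^ d * d) : ℕ) : ℝ≥0∞) ∂P := by simp
      _ ≤ ∫⁻ ω, 2 * ∑ η, ((L * numAlive (A.toAlgorithm ω) η : ℕ) : ℝ≥0∞) ∂P := by
          refine lintegral_mono fun ω => ?_
          have := Nat.mul_le_mul_left L (le_sum_numAlive (d := d) (A.toAlgorithm ω))
          rw [← hC, ← mul_assoc, mul_left_comm, Finset.mul_sum] at this
          have := (Nat.cast_le (α := ℝ≥0∞)).2 this
          push_cast at this ⊢
          exact this
      _ = 2 * ∑ η, ∫⁻ ω, ((L * numAlive (A.toAlgorithm ω) η : ℕ) : ℝ≥0∞) ∂P := by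
          have hmeas : ∀ η : Fin (2 ^ d * 2 ^ d) → Fin d → Bool, Measurable fun ω =>
              ((L * numAlive (A.toAlgorithm ω) η : ℕ) : ℝ≥0∞) := by
            intro η
            exact (measurable_from_top (f := fun k : ℕ => ((L * k : ℕ) : ℝ≥0∞))).comp
              (measurable_numAlive A η)
          rw [lintegral_const_mul _ (Finset.measurable_sum _ fun η _ => hmeas η),
            lintegral_finsetSum _ fun η _ => hmeas η]
      _ ≤ _ := by
          gcongr with η _ ω
          have := ENat.toENNReal_le.2 (mul_card_alive_le_cost (L := L)
            (T := 2 ^ d * ∑ b : Fin d → Bool, smallSize b) (A.toAlgorithm ω) η)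
          rwa [ENat.toENNReal_coe] at this
  have hopt : 2 * ∑ η : Fin (2 ^ d * 2 ^ d) → Fin d → Bool,
        ∫⁻ ω, ((hardInstance η).cost (A.toAlgorithm ω) : ℝ≥0∞) ∂P ≤
      ρ * ((13 * (L * C * 2 ^ d) : ℕ) : ℝ≥0∞) := by
    calc
      _ ≤ 2 * ∑ η : Fin (2 ^ d * 2 ^ d) → Fin d → Bool, ρ * ((hardInstance η).opt : ℝ≥0∞) := by
          gcongr with η _
          exact h _
      _ = ρ * ((2 * ∑ η : Fin (2 ^ d * 2 ^ d) → Fin d → Bool, (hardInstance η).opt : ℕ∞) :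
            ℝ≥0∞) := by
          rw [← Finset.mul_sum, ENat.toENNReal_mul, mul_left_comm]
          congr 2
          exact (map_sum ENat.toENNRealRingHom _ _).symm
      _ ≤ _ := by
          gcongr
          exact ENat.toENNReal_le.2 sum_opt_hardInstance_le
  have hfin := halg.trans hopt
  rw [show 13 * (L * C * 2 ^ d) = L * C * (13 * 2 ^ d) by ring, Nat.cast_mul, Nat.cast_mul (L * C),
    mul_left_comm] at hfin
  exact (ENNReal.mul_le_mul_iff_right (by exact_mod_cast hL0) (ENNReal.natCast_ne_top _)).1 hfin

end OpFlow

theorem mainTheorem7 :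
    ∃ c : ℝ≥0, 0 < c ∧
      ∀ (m : ℕ), 1 ≤ m →
        ∀ (Ω : Type*) [MeasurableSpace Ω] (P : Measure Ω) [IsProbabilityMeasure P]
          (A : OpFlow.RandomizedAlgorithm Ω),
          (c : ℝ≥0∞) * (m : ℝ≥0∞) ≤ OpFlow.competitiveRatio P A m := by
  refine ⟨1 / 26, by positivity, fun m hm Ω _ P _ A => le_sInf fun ρ hρ => ?_⟩
  obtain ⟨d, rfl⟩ : ∃ d, m = d + 1 := ⟨m - 1, by omega⟩
  have h := OpFlow.IsCompetitive.mul_le hρ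
  induction ρ using ENNReal.recTopCoe with
  | top => exact le_top
  | coe r =>
    have h1 : ((2 + 2 ^ d * d : ℕ) : ℝ≥0) ≤ r * ((13 * 2 ^ d : ℕ) : ℝ≥0) := by exact_mod_cast h
    -- For `d = 0` the summand `2` is needed, for `d ≥ 1` the summand `2 ^ d * d` suffices.
    have h2 : 2 ^ d * (d + 1) ≤ 2 * (2 + 2 ^ d * d) := by
      rcases Nat.eq_zero_or_pos d with rfl | hd
      · norm_num
      · nlinarith [Nat.mul_le_mul_left (2 ^ d) hd]
    have h3 : ((2 ^ d * (d + 1) : ℕ) : ℝ≥0) ≤ ((2 * (2 + 2 ^ d * d) : ℕ) : ℝ≥0) := by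
      exact_mod_cast h2
    have h4 : (1 / 26 : ℝ≥0) * ((d + 1 : ℕ) : ℝ≥0) ≤ r := by
      have hpos : (0 : ℝ) < 2 ^ d := by positivity
      rw [← NNReal.coe_le_coe] at h1 h3 ⊢
      push_cast at h1 h3 ⊢
      refine le_of_mul_le_mul_left ?_ hpos
      linarith
    exact_mod_cast h4
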